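/- For a prime $p$ let $\mathbb{Z}_p=\mathbb{Z}/p\mathbb{Z}$. (a) There is an absolute constant $C_3<1-2.27\cdot 10^{-12}$ such that the following holds. Let $0<\lambda\le \frac{9}{10}$, let $p>\frac{2}{\lambda}$ be a prime, and let $Y_1,Y_2,Y_3$ be independent, identically distributed random variables with values in $\mathbb{Z}_p$ such that $$\max_{x\in\mathbb{Z}_p}\mathbb{P}[Y_1=x]\le\lambda .$$ Then $$\max_{x\in\mathbb{Z}_p}\mathbb{P}[Y_1+Y_2+Y_3=x]\le C_3\,\lambda .$$ (b) For every $\lambda$ with $0<\lambda<1$ there is a constant $C_{3,\lambda}<1$, depending only on $\lambda$, such that for every prime $p>\frac{2}{\lambda}$ and all independent, identically distributed random variables $Y_1,Y_2,Y_3$ with values in $\mathbb{Z}_p$ satisfying $\max_{x\in\mathbb{Z}_p}\mathbb{P}[Y_1=x]\le\lambda$, $$\max_{x\in\mathbb{Z}_p}\mathbb{P}[Y_1+Y_2+Y_3=x]\le C_{3,\lambda}\,\lambda .$$ -/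

import Mathlib

open MeasureTheory ProbabilityTheory

/-! Let `f` be the common law and suppose `f * f * f` exceeds `(1 - δ ^ 2) * l` at a point. By a
Markov argument, `f * f ≥ (1 - δ) * l` on a set `S` with `#S * l > 1 - δ`. Two near-extremal
reflections of `f` compose to a translation, so `f` has correlation at least `(1 - 2 * δ) * l` with
its translate by each element of `S - S`. All correlations sum to 1, hence `#(S - S) * (1 - 2 * δ) *
l ≤ 1`. Cauchy–Davenport makes `S - S` too large for this. -/

open Finset Pointwise in
/-- In `ZMod p` the difference set of `S` has at least `min p (2 * #S - 1)` elements. -/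
theorem ZMod.min_le_card_sub_self {p : ℕ} [Fact p.Prime] {S : Finset (ZMod p)}
    (hS : S.Nonempty) : min p (2 * #S - 1) ≤ #(S - S) := by
  have h := ZMod.cauchy_davenport (Fact.out : p.Prime) hS hS.neg
  rw [card_neg, ← two_mul, ← sub_eq_add_neg] at h
  exact h

/-- If the product of one of three numbers in `[0, l]` with the two others is large, so is the
product of the two others. -/
theorem mul_add_mul_sub_le_mul {l a b c : ℝ} (ha : 0 ≤ a) (hal : a ≤ l) (hb : 0 ≤ b) (hbl : b ≤ l)
    (hc : 0 ≤ c) (hcl : c ≤ l) : a * b + a * c - l * a ≤ b * c := by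
  -- The claim is `a * (b + c - l) ≤ b * c`. If the bracket is nonnegative, the worst case is `a =
  -- l`, which is `0 ≤ (l - b) * (l - c)`; otherwise the left side is nonpositive.
  rcases le_total 0 (b + c - l) with h | h
  · nlinarith [mul_nonneg (sub_nonneg.2 hbl) (sub_nonneg.2 hcl), mul_nonneg (sub_nonneg.2 hal) h]
  · nlinarith [mul_nonneg hb hc, mul_nonneg ha (neg_nonneg.2 h)]

section Convolution

open Finset Pointwise

variable {G : Type*} [AddCommGroup G] [Fintype G]

/-- If `f` correlates well with its reflections about `y` and `y'`, then it correlates well with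
its translate by `y - y'`. -/
theorem le_sum_mul_translate {f : G → ℝ} {l δ : ℝ} (hf0 : ∀ x, 0 ≤ f x) (hfl : ∀ x, f x ≤ l)
    (hf1 : ∑ x, f x = 1) {y y' : G} (hy : (1 - δ) * l ≤ ∑ z, f z * f (y - z))
    (hy' : (1 - δ) * l ≤ ∑ z, f z * f (y' - z)) :
    (1 - 2 * δ) * l ≤ ∑ z, f z * f (z + (y - y')) := by
  have h1 : ∑ z, f z * f (z + (y - y')) = ∑ w, f (y - w) * f (y' - w) := by
    rw [← Equiv.sum_comp (Equiv.subLeft y')]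
    refine sum_congr rfl fun w _ => ?_
    rw [Equiv.subLeft_apply, mul_comm, show y' - w + (y - y') = y - w by abel]
  have h2 : ∑ w, (f w * f (y - w) + f w * f (y' - w) - l * f w) ≤ ∑ w, f (y - w) * f (y' - w) :=
    sum_le_sum fun w _ => mul_add_mul_sub_le_mul (hf0 _) (hfl _) (hf0 _) (hfl _) (hf0 _) (hfl _)
  rw [sum_sub_distrib, sum_add_distrib, ← mul_sum, hf1] at h2
  rw [h1]
  linarith

/-- The correlations of a function with all its translates sum to the square of its total mass. -/
theorem sum_sum_mul_translate (f : G → ℝ) :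
    ∑ d, ∑ z, f z * f (z + d) = (∑ x, f x) ^ 2 := by
  rw [sum_comm, sq, sum_mul]
  refine sum_congr rfl fun z _ => ?_
  rw [← mul_sum]
  congr 1
  exact Equiv.sum_comp (Equiv.addLeft z) f

theorem sum_mul_reflect_le {f : G → ℝ} {l : ℝ} (hf0 : ∀ x, 0 ≤ f x) (hfl : ∀ x, f x ≤ l)
    (hf1 : ∑ x, f x = 1) (y : G) : ∑ z, f z * f (y - z) ≤ l := by
  calc ∑ z, f z * f (y - z) ≤ ∑ z, f z * l :=
        sum_le_sum fun z _ => mul_le_mul_of_nonneg_left (hfl _) (hf0 _)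
    _ = l := by rw [← sum_mul, hf1, one_mul]

/-- If the triple convolution of `f` nearly attains the trivial bound `l` at a point, then the
convolution square of `f` nearly attains it on a set of more than `(1 - δ) / l` points. -/
theorem lt_card_mul_of_lt_sum {f : G → ℝ} {l δ : ℝ} (hf0 : ∀ x, 0 ≤ f x)
    (hfl : ∀ x, f x ≤ l) (hf1 : ∑ x, f x = 1) (hl : 0 < l) (hδ : 0 < δ) {x : G}
    (hx : (1 - δ ^ 2) * l < ∑ y, f (x - y) * ∑ z, f z * f (y - z)) :
    1 - δ < #{y | (1 - δ) * l ≤ ∑ z, f z * f (y - z)} * l := by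
  classical
  set S : Finset G := {y | (1 - δ) * l ≤ ∑ z, f z * f (y - z)} with hS
  have hmass : ∑ y, f (x - y) = 1 := by rw [← hf1]; exact Equiv.sum_comp (Equiv.subLeft x) f
  -- Markov: `f * f` is below `(1 - δ) * l` off `S` and at most `l` on `S`, so `x - S` must carry
  -- mass above `1 - δ`.
  have h1 : ∑ y, f (x - y) * ∑ z, f z * f (y - z)
      ≤ ∑ y, (f (x - y) * ((1 - δ) * l) + if y ∈ S then f (x - y) * (δ * l) else 0) := by
    refine sum_le_sum fun y _ => ?_
    split_ifs with hy
    · rw [← mul_add]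
      refine mul_le_mul_of_nonneg_left ?_ (hf0 _)
      linarith [sum_mul_reflect_le hf0 hfl hf1 y]
    · rw [add_zero]
      refine mul_le_mul_of_nonneg_left ?_ (hf0 _)
      simp only [hS, mem_filter_univ, not_le] at hy
      exact hy.le
  rw [sum_add_distrib, ← sum_mul, hmass, sum_ite_mem, univ_inter, ← sum_mul] at h1
  have h2 : ∑ y ∈ S, f (x - y) ≤ #S * l := by
    rw [← nsmul_eq_mul]
    exact sum_le_card_nsmul _ _ _ fun y _ => hfl _
  have h3 : (1 - δ) * (δ * l) < (∑ y ∈ S, f (x - y)) * (δ * l) := by linarith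
  exact (lt_of_mul_lt_mul_right h3 (by positivity)).trans_le h2

/-- The triple convolution of a probability mass function on `ZMod p` bounded by `l` is bounded
away from `l`. -/
theorem ZMod.sum_mul_sum_mul_le {p : ℕ} [Fact p.Prime] {f : ZMod p → ℝ} {l δ : ℝ}
    (hf0 : ∀ x, 0 ≤ f x) (hfl : ∀ x, f x ≤ l) (hf1 : ∑ x, f x = 1) (hl : 0 < l) (hδ : 0 < δ)
    (hδ' : δ ≤ 1 / 20) (hlδ : l ≤ 1 - δ) (hp : 2 < p * l) (x : ZMod p) :
    ∑ y, f (x - y) * ∑ z, f z * f (y - z) ≤ (1 - δ ^ 2) * l := by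
  by_contra! hx
  have hcard := lt_card_mul_of_lt_sum hf0 hfl hf1 hl hδ hx
  set S : Finset (ZMod p) := {y | (1 - δ) * l ≤ ∑ z, f z * f (y - z)} with hS
  -- With at most one point, `1 - δ < #S * l ≤ l`, against `hlδ`.
  have hS2 : 2 ≤ #S := by
    by_contra! h
    have : (#S : ℝ) ≤ 1 := by exact_mod_cast Nat.le_of_lt_succ h
    nlinarith
  have hcorr : #(S - S) * ((1 - 2 * δ) * l) ≤ 1 := by
    calc (#(S - S) : ℝ) * ((1 - 2 * δ) * l) ≤ ∑ d ∈ S - S, ∑ z, f z * f (z + d) := by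
          rw [← nsmul_eq_mul]
          refine card_nsmul_le_sum _ _ _ fun d hd => ?_
          obtain ⟨y, hy, y', hy', rfl⟩ := mem_sub.1 hd
          simp only [hS, mem_filter_univ] at hy hy'
          exact le_sum_mul_translate hf0 hfl hf1 hy hy'
      _ ≤ ∑ d, ∑ z, f z * f (z + d) :=
          sum_le_sum_of_subset_of_nonneg (subset_univ _) fun d _ _ =>
            sum_nonneg fun z _ => mul_nonneg (hf0 _) (hf0 _)
      _ = 1 := by rw [sum_sum_mul_translate, hf1, one_pow]
  have hpos : 0 < (1 - 2 * δ) * l := mul_pos (by linarith) hl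
  rcases min_le_iff.1 (ZMod.min_le_card_sub_self (card_pos.1 (by omega : 0 < #S))) with h | h
  -- Here `p * l * (1 - 2 * δ) > 2 * 0.9 > 1`.
  · have h' : (p : ℝ) ≤ #(S - S) := by exact_mod_cast h
    nlinarith [mul_le_mul_of_nonneg_right h' hpos.le]
  -- `2 * n - 1 ≥ 3 * n / 2` once `n ≥ 2`, and `1.5 * 0.95 * 0.9 > 1`.
  · have h' : (3 / 2 : ℝ) * #S ≤ #(S - S) := by
      have h3 : 3 * #S ≤ 2 * #(S - S) := by omega
      have h4 : (3 : ℝ) * #S ≤ 2 * #(S - S) := by exact_mod_cast h3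
      linarith
    nlinarith [mul_le_mul_of_nonneg_right h' hpos.le]

end Convolution

section Independence

variable {Ω : Type*} [MeasurableSpace Ω] {P : Measure Ω} [IsProbabilityMeasure P]

/-- The law of the sum of three independent identically distributed random variables with values
in a finite group is the triple convolution of their common law. -/
theorem ProbabilityTheory.iIndepFun.measureReal_add_add_eq {G : Type*} [AddCommGroup G] [Fintype G]
    [MeasurableSpace G] [MeasurableSingletonClass G] {Y : Fin 3 → Ω → G}
    (hm : ∀ i, Measurable (Y i)) (hY : iIndepFun Y P) (hid : ∀ i, IdentDistrib (Y i) (Y 0) P P)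
    (x : G) :
    P.real {ω | Y 0 ω + Y 1 ω + Y 2 ω = x} =
      ∑ y, P.real {ω | Y 0 ω = x - y} *
        ∑ z, P.real {ω | Y 0 ω = z} * P.real {ω | Y 0 ω = y - z} := by
  classical
  have hlaw (i : Fin 3) (a : G) : P.real {ω | Y i ω = a} = P.real {ω | Y 0 ω = a} :=
    congrArg ENNReal.toReal ((hid i).measure_mem_eq (measurableSet_singleton a))
  have hjoint (a b c : G) : P.real {ω | Y 0 ω = a ∧ Y 1 ω = b ∧ Y 2 ω = c} =
      P.real {ω | Y 0 ω = a} * (P.real {ω | Y 0 ω = b} * P.real {ω | Y 0 ω = c}) := by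
    have h := hY.measure_inter_preimage_eq_mul Finset.univ (sets := ![{a}, {b}, {c}])
      fun i _ => (Set.toFinite _).measurableSet
    have hset : (⋂ i ∈ (Finset.univ : Finset (Fin 3)), Y i ⁻¹' (![{a}, {b}, {c}] : _ → Set G) i) =
        {ω | Y 0 ω = a ∧ Y 1 ω = b ∧ Y 2 ω = c} := by
      ext ω
      simp [Fin.forall_fin_succ]
    rw [hset, Fin.prod_univ_three] at h
    rw [← hlaw 1 b, ← hlaw 2 c, ← mul_assoc, Measure.real, h, ENNReal.toReal_mul,
      ENNReal.toReal_mul]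
    rfl
  -- The index `q` records `(Y 0 + Y 1, Y 0)`, matching the nested sums over `y` and `z`.
  have hunion : {ω | Y 0 ω + Y 1 ω + Y 2 ω = x} =
      ⋃ q ∈ (Finset.univ : Finset (G × G)),
        {ω | Y 0 ω = q.2 ∧ Y 1 ω = q.1 - q.2 ∧ Y 2 ω = x - q.1} := by
    ext ω
    simp only [Set.mem_ofPred_eq, Finset.mem_univ, Set.iUnion_true, Set.mem_iUnion]
    constructor
    · rintro rfl
      exact ⟨(Y 0 ω + Y 1 ω, Y 0 ω), rfl, by simp, by simp⟩
    · rintro ⟨q, h0, h1, h2⟩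
      rw [h0, h1, h2]
      abel
  rw [hunion, measureReal_biUnion_finset, ← Finset.univ_product_univ, Finset.sum_product]
  · refine Finset.sum_congr rfl fun y _ => ?_
    rw [Finset.mul_sum]
    refine Finset.sum_congr rfl fun z _ => ?_
    rw [hjoint]
    ring
  · intro q _ r _ hqr
    refine Set.disjoint_left.2 fun ω hq hr => hqr ?_
    have h2 : q.2 = r.2 := hq.1.symm.trans hr.1
    have h1 : x - q.1 = x - r.1 := hq.2.2.symm.trans hr.2.2
    exact Prod.ext (sub_right_injective h1) h2
  · intro q _
    exact (hm 0 (measurableSet_singleton _)).inter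
      ((hm 1 (measurableSet_singleton _)).inter (hm 2 (measurableSet_singleton _)))

theorem sum_measureReal_eq_one {α : Type*} [Fintype α] [MeasurableSpace α]
    [MeasurableSingletonClass α] {X : Ω → α} (hX : Measurable X) :
    ∑ a, P.real {ω | X ω = a} = 1 := by
  have h := sum_measureReal_preimage_singleton (μ := P) (f := X) Finset.univ
    fun a _ => hX (measurableSet_singleton a)
  simpa [Set.preimage] using h

/-- The largest atom of the sum of three independent identically distributed random variables in
`ZMod p` is smaller than the bound on their atoms by a constant factor. -/
theorem ZMod.measureReal_add_add_le {p : ℕ} [Fact p.Prime] {Y : Fin 3 → Ω → ZMod p} {l δ : ℝ}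
    (hl : 0 < l) (hδ : 0 < δ) (hδ' : δ ≤ 1 / 20) (hlδ : l ≤ 1 - δ) (hp : 2 / l < p)
    (hm : ∀ i, Measurable (Y i)) (hY : iIndepFun Y P) (hid : ∀ i, IdentDistrib (Y i) (Y 0) P P)
    (hYl : ∀ x, P.real {ω | Y 0 ω = x} ≤ l) (x : ZMod p) :
    P.real {ω | Y 0 ω + Y 1 ω + Y 2 ω = x} ≤ (1 - δ ^ 2) * l := by
  rw [hY.measureReal_add_add_eq hm hid]
  exact ZMod.sum_mul_sum_mul_le (f := fun a => P.real {ω | Y 0 ω = a})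
    (fun _ => measureReal_nonneg) hYl (sum_measureReal_eq_one (hm 0)) hl hδ hδ' hlδ
    ((div_lt_iff₀ hl).1 hp) x

end Independence

theorem mainTheorem1 :
    (∃ C₃ : ℝ, C₃ < 1 - 2.27 / 10 ^ 12 ∧
      ∀ (lam : ℝ) (p : ℕ) [Fact p.Prime] (Ω : Type*) [MeasurableSpace Ω]
        (P : Measure Ω) [IsProbabilityMeasure P] (Y : Fin 3 → Ω → ZMod p),
        0 < lam → lam ≤ 9 / 10 → 2 / lam < (p : ℝ) →
        (∀ i, Measurable (Y i)) → iIndepFun Y P → (∀ i, IdentDistrib (Y i) (Y 0) P P) →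
        (∀ x : ZMod p, P.real {ω | Y 0 ω = x} ≤ lam) →
        ∀ x : ZMod p, P.real {ω | Y 0 ω + Y 1 ω + Y 2 ω = x} ≤ C₃ * lam) ∧
    (∀ lam : ℝ, 0 < lam → lam < 1 →
      ∃ C : ℝ, C < 1 ∧
        ∀ (p : ℕ) [Fact p.Prime] (Ω : Type*) [MeasurableSpace Ω]
          (P : Measure Ω) [IsProbabilityMeasure P] (Y : Fin 3 → Ω → ZMod p),
          2 / lam < (p : ℝ) →
          (∀ i, Measurable (Y i)) → iIndepFun Y P → (∀ i, IdentDistrib (Y i) (Y 0) P P) →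
          (∀ x : ZMod p, P.real {ω | Y 0 ω = x} ≤ lam) →
          ∀ x : ZMod p, P.real {ω | Y 0 ω + Y 1 ω + Y 2 ω = x} ≤ C * lam) := by
  constructor
  · refine ⟨1 - (1 / 20) ^ 2, by norm_num, ?_⟩
    intro lam p _ Ω _ P _ Y hl hl' hp hm hY hid hYl
    exact ZMod.measureReal_add_add_le hl (by norm_num) le_rfl (by linarith) hp hm hY hid hYl
  · intro lam hl hl'
    -- The second term of the minimum secures `lam ≤ 1 - δ`, needed for `2 ≤ #S`.
    have hδ : 0 < min (1 / 20) (1 - lam) := lt_min (by norm_num) (by linarith)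
    refine ⟨1 - min (1 / 20) (1 - lam) ^ 2, by linarith [pow_pos hδ 2], ?_⟩
    intro p _ Ω _ P _ Y hp hm hY hid hYl
    exact ZMod.measureReal_add_add_le hl hδ (min_le_left _ _)
      (by linarith [min_le_right (1 / 20) (1 - lam)]) hp hm hY hid hYl
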